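/- Let $q$ be a prime power and let $n>2$ be an integer. The field reduction map $\mathcal F$ sends a point of $\mathrm{PG}(1,q^n)$, i.e. a one-dimensional $\mathbb F_{q^n}$-subspace of $\mathbb F_{q^n}^2$, to the same set regarded as an $n$-dimensional $\mathbb F_q$-subspace of $\mathbb F_{q^n}^2$, that is, to an $(n-1)$-dimensional projective subspace of the projective space $\mathrm{PG}(2n-1,q)$ of the $\mathbb F_q$-vector space $\mathbb F_{q^n}^2$. For a set $L$ of points of $\mathrm{PG}(1,q^n)$, let $\tilde{\mathcal F}(L)$ be the set of all points of $\mathrm{PG}(2n-1,q)$ lying on some $\mathcal F(P)$, $P\in L$. An $\mathbb F_q$-club with head $\Upsilon$ is a point set of the form $L=\{\langle u\rangle_{\mathbb F_{q^n}} : u\in U\setminus\{0\}\}$, where $U$ is a three-dimensional $\mathbb F_q$-subspace of $\mathbb F_{q^n}^2$, together with a point $\Upsilon$ of weight two, i.e. such that $\dim_{\mathbb F_q}(U\cap\Upsilon)=2$. Such an $L$ is called isomorphic to $\mathrm{PG}(1,q^2)$ if $n$ is even and some projectivity of $\mathrm{PG}(1,q^n)$ maps onto $L$ the set of points having homogeneous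 coordinates in $\mathbb F_{q^2}$. Dimensions of subspaces below are projective. Let $L$ be an $\mathbb F_q$-club of $\mathrm{PG}(1,q^n)$ with head $\Upsilon$. Then there are two collections $F_1$ and $F_2$ of subspaces of $\mathrm{PG}(2n-1,q)$, all contained in $\tilde{\mathcal F}(L)$, such that: (i) the subspaces in $F_1$ are $(n-1)$-dimensional and pairwise disjoint, and each of them is disjoint from $\mathcal F(\Upsilon)$; (ii) each subspace in $F_2$ is a plane and intersects $\mathcal F(\Upsilon)$ in precisely a line; (iii) each point of $\mathcal F(\Upsilon)$ belongs to exactly $q+1$ planes in $F_2$; (iv) if $q>2$, $L$ is not isomorphic to $\mathrm{PG}(1,q^2)$, and $l$ is any line of $\mathrm{PG}(2n-1,q)$ contained in $\tilde{\mathcal F}(L)$, then $l$ is contained in $\mathcal F(\Upsilon)$ or in a subspace belonging to $F_1\cup F_2$. -/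

import Mathlib

open scoped LinearAlgebra.Projectivization

/-! Throughout, `K` is a field extension of `F` of degree `n`, `|F| = q`.  The projective line
`PG(1,q^n)` is `ℙ K (Fin 2 → K)`, and `PG(2n-1,q)` is the projective space of the `F`-vector space
underlying `K²`.  Its points are the elements of `ℙ F (Fin 2 → K)`, and its `d`-dimensional
projective subspaces are the `F`-subspaces of `K²` of vector-space dimension `d + 1`. -/

namespace LinearSetClub

variable (F : Type*) {K : Type*} [Field F] [Field K] [Algebra F K]

/-- The field reduction map `PG(1,q^n) → PG(2n-1,q)`: a point, i.e. a one-dimensional `K`-subspace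
of `K²`, is sent to the same subset of `K²`, regarded as an `F`-subspace (of dimension `n`). -/
def fieldReduction (P : ℙ K (Fin 2 → K)) : Submodule F (Fin 2 → K) :=
  P.submodule.restrictScalars F

variable {F}

/-- The set of points of `PG(2n-1,q)` lying on a given projective subspace. -/
def points (S : Submodule F (Fin 2 → K)) : Set (ℙ F (Fin 2 → K)) :=
  {x | x.submodule ≤ S}

variable (F) in
/-- The set of points of `PG(2n-1,q)` covered by the field reductions of the points of `L`. -/
def reducedPoints (L : Set (ℙ K (Fin 2 → K))) : Set (ℙ F (Fin 2 → K)) :=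
  ⋃ P ∈ L, points (fieldReduction F P)

/-- The `F`-linear set of `PG(1,q^n)` defined by an `F`-subspace `U` of `K²`: all points spanned
over `K` by the nonzero vectors of `U`.  Its rank is the dimension of `U` over `F`. -/
def linearSet (U : Submodule F (Fin 2 → K)) : Set (ℙ K (Fin 2 → K)) :=
  {P | ∃ u ∈ U, ∃ hu : u ≠ 0, Projectivization.mk K u hu = P}

/-- The weight of a point with respect to the linear set defined by `U`. -/
noncomputable def weight (U : Submodule F (Fin 2 → K)) (P : ℙ K (Fin 2 → K)) : ℕ :=
  Module.finrank F ↥(U ⊓ fieldReduction F P)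

variable (F) in
/-- `L` is an `F`-club with head `Y`: an `F`-linear set of rank three in which the point `Y` has
weight two. -/
def IsClubWithHead (L : Set (ℙ K (Fin 2 → K))) (Y : ℙ K (Fin 2 → K)) : Prop :=
  ∃ U : Submodule F (Fin 2 → K),
    Module.finrank F U = 3 ∧ L = linearSet U ∧ weight U Y = 2

/-- The canonical subline `PG(1,E)` of `PG(1,K)` for a subfield `E` of `K`: the points having
homogeneous coordinates in `E`. -/
def canonicalSubline (E : IntermediateField F K) : Set (ℙ K (Fin 2 → K)) :=
  {P | ∃ v : Fin 2 → K, (∀ i, v i ∈ E) ∧ ∃ hv : v ≠ 0, Projectivization.mk K v hv = P}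

variable (F) in
/-- `L` is isomorphic to `PG(1,q²)`: some projectivity of `PG(1,q^n)` maps the canonical subline
over the subfield of order `q²` (which then has to exist) onto `L`. -/
def IsIsomorphicToQuadraticSubline (L : Set (ℙ K (Fin 2 → K))) : Prop :=
  ∃ E : IntermediateField F K, Module.finrank F E = 2 ∧
    ∃ g : (Fin 2 → K) ≃ₗ[K] (Fin 2 → K),
      L = Projectivization.map g.toLinearMap g.injective '' canonicalSubline E

end LinearSetClub

open scoped Pointwise

namespace LinearSetClub

/-! ### Field reduction, and multiplication of subspaces by units of `K`. -/

variable {F K : Type*} [Field F] [Field K] [Algebra F K]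

/-! Let `U` define the club with head `Y`. `F₁` consists of the field reductions of the points of
`L` other than `Y`, and `F₂` of the multiples `k • U`, `k : Kˣ`. Everything rests on `U ∩ Y` having
codimension one in `U`: modulo the head, `U` is a single `F`-line (`exists_sub_smul_mem_head`).
Hence `k • U` determines `k` up to scalars in `F`, and the planes through a point of the head
correspond to the `q + 1` projective points of `U ∩ Y`.

For (iv), consider a covered line outside the head. If it meets the head, comparing vectors modulo
`Y` puts it in one `k • U`. If it misses the head and lies in no `fieldReduction F P`, rescaling
makes it join `v` to `k • (v + d)` with `v, d ∈ U`, `d ∈ Y`, `k ∉ F`. As its points are covered, `U`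
contains `(1 + t k)⁻¹ d` for all `t : F` (`div_one_add_smul_mem`). The coordinates of `U ∩ Y` along
`d` form a two-dimensional space containing these values; `t = 0, 1` and one further `t` already
force it to be a quadratic field `E` (`exists_intermediateField_of_finrank_two`). Then `U = F v + E
d`, so `L` is equivalent to the subline over `E`, the excluded case. -/

theorem mk_mem_points {S : Submodule F (Fin 2 → K)} {v : Fin 2 → K} (hv : v ≠ 0) :
    Projectivization.mk F v hv ∈ points S ↔ v ∈ S := by
  simp [points]

theorem mem_fieldReduction {P : ℙ K (Fin 2 → K)} {v : Fin 2 → K} :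
    v ∈ fieldReduction F P ↔ v ∈ P.submodule := Iff.rfl

theorem points_subset_reducedPoints_linearSet_iff {S U : Submodule F (Fin 2 → K)} :
    points S ⊆ reducedPoints F (linearSet U) ↔
      ∀ v ∈ S, v ≠ 0 → ∃ u ∈ U, ∃ k : K, k • u = v := by
  constructor
  · intro h v hv hv0
    have h1 := h ((mk_mem_points hv0).2 hv)
    simp only [reducedPoints, Set.mem_iUnion] at h1
    obtain ⟨P, ⟨u, hu, hu0, rfl⟩, hP⟩ := h1
    rw [mk_mem_points, mem_fieldReduction, Projectivization.submodule_mk,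
      Submodule.mem_span_singleton] at hP
    exact ⟨u, hu, hP⟩
  · intro h x
    induction x using Projectivization.ind with
    | h v hv0 =>
      intro hv
      obtain ⟨u, hu, k, hk⟩ := h v ((mk_mem_points hv0).1 hv) hv0
      have hu0 : u ≠ 0 := by rintro rfl; simp at hk; exact hv0 hk.symm
      simp only [reducedPoints, Set.mem_iUnion]
      refine ⟨_, ⟨u, hu, hu0, rfl⟩, ?_⟩
      rw [mk_mem_points, mem_fieldReduction, Projectivization.submodule_mk,
        Submodule.mem_span_singleton]
      exact ⟨k, hk⟩

theorem disjoint_points_of_disjoint {S T : Submodule F (Fin 2 → K)} (h : Disjoint S T) :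
    Disjoint (points S) (points T) := by
  rw [Set.disjoint_left]
  intro x
  induction x using Projectivization.ind with
  | h v hv0 =>
    intro h1 h2
    rw [mk_mem_points] at h1 h2
    exact hv0 (Submodule.disjoint_def.1 h v h1 h2)

theorem submodule_eq_span {P : ℙ K (Fin 2 → K)} {v : Fin 2 → K} (hv0 : v ≠ 0)
    (hv : v ∈ P.submodule) : P.submodule = K ∙ v := by
  refine (Submodule.eq_of_le_of_finrank_le ((Submodule.span_singleton_le_iff_mem _ _).2 hv) ?_).symm
  rw [P.finrank_submodule, finrank_span_singleton hv0]

theorem disjoint_fieldReduction {P Q : ℙ K (Fin 2 → K)} (h : P ≠ Q) :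
    Disjoint (fieldReduction F P) (fieldReduction F Q) := by
  rw [Submodule.disjoint_def]
  intro v hP hQ
  by_contra hv
  exact h (Projectivization.submodule_injective
    ((submodule_eq_span hv hP).trans (submodule_eq_span hv hQ).symm))

theorem finrank_fieldReduction (P : ℙ K (Fin 2 → K)) :
    Module.finrank F (fieldReduction F P) = Module.finrank F K := by
  have h := Module.finrank_mul_finrank F K P.submodule
  rw [P.finrank_submodule, mul_one] at h
  exact h.symm

theorem mem_units_smul_iff {U : Submodule F (Fin 2 → K)} {k : Kˣ} {v : Fin 2 → K} :
    v ∈ k • U ↔ k⁻¹ • v ∈ U := by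
  refine (Submodule.mem_smul_pointwise_iff_exists v k U).trans ?_
  constructor
  · rintro ⟨u, hu, rfl⟩; simpa using hu
  · intro h; exact ⟨_, h, by simp⟩

theorem finrank_units_smul (U : Submodule F (Fin 2 → K)) (k : Kˣ) :
    Module.finrank F ↥(k • U) = Module.finrank F U :=
  LinearEquiv.finrank_map_eq (DistribMulAction.toLinearEquiv F (Fin 2 → K) k) U

/-- The head is a `K`-subspace, so units of `K` preserve it. -/
theorem units_smul_inf_fieldReduction (U : Submodule F (Fin 2 → K)) (k : Kˣ)
    (Y : ℙ K (Fin 2 → K)) :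
    k • U ⊓ fieldReduction F Y = k • (U ⊓ fieldReduction F Y) := by
  ext v
  simp only [Submodule.mem_inf, mem_units_smul_iff, mem_fieldReduction]
  refine and_congr_right fun _ => ?_
  rw [Units.smul_def]
  exact (Y.submodule.smul_mem_iff (by simp)).symm

/-! ### Clubs modulo the head, and the planes `k • U`. -/

section Club

variable {U : Submodule F (Fin 2 → K)} {Y : ℙ K (Fin 2 → K)}

/-- Modulo the head, the subspace defining a club is spanned by any of its vectors outside of
the head. -/
theorem exists_sub_smul_mem_head [FiniteDimensional F K] (hU : Module.finrank F U = 3)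
    (hY : weight U Y = 2) {v u : Fin 2 → K} (hv : v ∈ U) (hvY : v ∉ Y.submodule) (hu : u ∈ U) :
    ∃ a : F, u - a • v ∈ Y.submodule := by
  set D := U ⊓ fieldReduction F Y with hD
  have hlt : D < D ⊔ F ∙ v := by
    refine lt_of_le_of_ne le_sup_left fun h => hvY ?_
    have : v ∈ D := h ▸ Submodule.mem_sup_right (Submodule.mem_span_singleton_self v)
    exact this.2
  have hle : D ⊔ F ∙ v ≤ U :=
    sup_le inf_le_left ((Submodule.span_singleton_le_iff_mem _ _).2 hv)
  have h2 : Module.finrank F D = 2 := hY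
  have h3 := Submodule.finrank_lt_finrank_of_lt hlt
  have h4 := Submodule.eq_of_le_of_finrank_le hle (by omega)
  rw [← h4] at hu
  obtain ⟨d, hd, w, hw, rfl⟩ := Submodule.mem_sup.1 hu
  obtain ⟨a, rfl⟩ := Submodule.mem_span_singleton.1 hw
  exact ⟨a, by rw [add_sub_cancel_right]; exact hd.2⟩

theorem exists_mem_not_mem_head (hU : Module.finrank F U = 3) (hY : weight U Y = 2) :
    ∃ v ∈ U, v ∉ Y.submodule := by
  by_contra! h
  have : U ⊓ fieldReduction F Y = U := inf_eq_left.2 h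
  rw [weight, this] at hY
  omega

theorem algebraMap_smul_vec (a : F) (v : Fin 2 → K) : algebraMap F K a • v = a • v :=
  algebraMap_smul K a v

/-- A scalar that maps some vector of the defining subspace outside of the head into this subspace
lies in the ground field. -/
theorem exists_algebraMap_eq_of_smul_mem [FiniteDimensional F K] (hU : Module.finrank F U = 3)
    (hY : weight U Y = 2) {v : Fin 2 → K} (hv : v ∈ U) (hvY : v ∉ Y.submodule) {c : K}
    (hc : c • v ∈ U) : ∃ a : F, algebraMap F K a = c := by
  obtain ⟨a, ha⟩ := exists_sub_smul_mem_head hU hY hv hvY hc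
  refine ⟨a, ?_⟩
  by_contra hne
  rw [← algebraMap_smul_vec a v, ← sub_smul] at ha
  exact hvY ((Y.submodule.smul_mem_iff (sub_ne_zero.2 (Ne.symm hne))).1 ha)

/-- Gives the injectivity needed to count planes through a point of the head. -/
theorem exists_algebraMap_eq_of_units_smul_eq [FiniteDimensional F K]
    (hU : Module.finrank F U = 3) (hY : weight U Y = 2) {k k' : Kˣ} (h : k • U = k' • U) :
    ∃ a : F, algebraMap F K a = (k : K)⁻¹ * k' := by
  obtain ⟨v, hv, hvY⟩ := exists_mem_not_mem_head hU hY
  have h1 : k' • v ∈ k • U := h ▸ Submodule.smul_mem_pointwise_smul v k' U hv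
  rw [mem_units_smul_iff, smul_smul, Units.smul_def] at h1
  push_cast at h1
  exact exists_algebraMap_eq_of_smul_mem hU hY hv hvY h1

/-- Each point of the head lies on `q + 1` multiples of the plane defining the club. -/
theorem ncard_units_smul_through_point [Finite F] [FiniteDimensional F K]
    (hU : Module.finrank F U = 3) (hY : weight U Y = 2) {v : Fin 2 → K} (hv0 : v ≠ 0)
    (hv : v ∈ Y.submodule) :
    {S | S ∈ Set.range (fun k : Kˣ => k • U) ∧ v ∈ S}.ncard = Nat.card F + 1 := by
  set D := U ⊓ fieldReduction F Y with hD
  have key : ∀ w : Fin 2 → K, w ∈ D → w ≠ 0 → ∃ k : Kˣ, k • w = v := by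
    intro w hw hw0
    have h1 := submodule_eq_span hw0 hw.2
    rw [h1, Submodule.mem_span_singleton] at hv
    obtain ⟨k, hk⟩ := hv
    have hk0 : k ≠ 0 := by rintro rfl; simp at hk; exact hv0 hk.symm
    exact ⟨Units.mk0 k hk0, hk⟩
  have key' : ∀ P : ℙ F D, ∃ k : Kˣ, k • (P.rep : Fin 2 → K) = v := fun P =>
    key _ P.rep.2 (by simpa using P.rep_nonzero)
  choose k hk using key'
  -- The plane `c • U` through `v` is indexed by the point of `U ∩ Y` spanned by `c⁻¹ • v`.
  have himage : {S | S ∈ Set.range (fun k : Kˣ => k • U) ∧ v ∈ S} =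
      (fun P => k P • U) '' Set.univ := by
    ext S
    simp only [Set.mem_ofPred_eq, Set.image_univ, Set.mem_range]
    constructor
    · rintro ⟨⟨c, rfl⟩, hc⟩
      rw [mem_units_smul_iff] at hc
      have hcY : c⁻¹ • v ∈ D := by
        refine ⟨hc, ?_⟩
        rw [Units.smul_def]
        exact Y.submodule.smul_mem _ hv
      have hc0 : (⟨c⁻¹ • v, hcY⟩ : D) ≠ 0 := by
        intro h
        exact hv0 ((smul_eq_zero_iff_eq _).1 (congrArg Subtype.val h))
      refine ⟨Projectivization.mk F ⟨c⁻¹ • v, hcY⟩ hc0, ?_⟩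
      set P := Projectivization.mk F (⟨c⁻¹ • v, hcY⟩ : D) hc0 with hP
      obtain ⟨a, ha⟩ := Projectivization.exists_smul_eq_mk_rep F _ hc0
      rw [← hP] at ha
      have ha' : (a : F) • c⁻¹ • v = (P.rep : Fin 2 → K) := by rw [← ha]; rfl
      have hkP := hk P
      rw [← ha', ← algebraMap_smul_vec, Units.smul_def, Units.smul_def, smul_smul, smul_smul] at hkP
      have h1 : (k P : K) * (algebraMap F K a * (c⁻¹ : Kˣ)) = 1 := by
        have : ((k P : K) * (algebraMap F K a * (c⁻¹ : Kˣ)) - 1) • v = 0 := by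
          rw [sub_smul, one_smul, ← mul_assoc, hkP, sub_self]
        exact sub_eq_zero.1 ((smul_eq_zero.1 this).resolve_right hv0)
      have h2 : (c : K) = (k P : K) * algebraMap F K a := by
        have : (c : K) ≠ 0 := c.ne_zero
        push_cast at h1
        field_simp at h1
        exact h1.symm
      ext u
      rw [mem_units_smul_iff, mem_units_smul_iff]
      have h3 : (k P)⁻¹ • u = (a : F) • c⁻¹ • u := by
        rw [← algebraMap_smul_vec, Units.smul_def, Units.smul_def, smul_smul]
        congr 1
        push_cast
        rw [h2]
        have : algebraMap F K a ≠ 0 := by simp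
        field_simp
      rw [h3]
      exact U.smul_mem_iff a.ne_zero
    · rintro ⟨P, rfl⟩
      refine ⟨⟨_, rfl⟩, ?_⟩
      rw [mem_units_smul_iff, ← hk P]
      simpa using P.rep.2.1
  have hinj : Function.Injective fun P => k P • U := by
    intro P Q hPQ
    obtain ⟨a, ha⟩ := exists_algebraMap_eq_of_units_smul_eq hU hY hPQ
    rw [← P.mk_rep, ← Q.mk_rep, Projectivization.mk_eq_mk_iff']
    refine ⟨a, Subtype.ext ?_⟩
    have h1 : (k P)⁻¹ • v = (P.rep : Fin 2 → K) := by rw [← hk P, inv_smul_smul]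
    rw [Submodule.coe_smul, ← algebraMap_smul_vec, ha, ← h1, ← hk Q, mul_smul]
    simp [Units.smul_def]
  rw [himage, Set.ncard_image_of_injective _ hinj, Set.ncard_univ,
    Projectivization.card_of_finrank_two F D hY]

/-- A line containing a point of the head is contained in the head or in a multiple of the plane
defining the club. -/
theorem le_units_smul_of_mem_head [FiniteDimensional F K] (hU : Module.finrank F U = 3)
    (hY : weight U Y = 2) {u v : Fin 2 → K} (hu : u ∈ Y.submodule) (hv : v ∉ Y.submodule)
    (hvU : ∃ w ∈ U, ∃ k : K, k • w = v) (huvU : ∃ w ∈ U, ∃ k : K, k • w = v + u) :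
    ∃ k : Kˣ, v ∈ k • U ∧ u ∈ k • U := by
  obtain ⟨v', hv', k, rfl⟩ := hvU
  have hk0 : k ≠ 0 := by rintro rfl; simp at hv
  have hv'Y : v' ∉ Y.submodule := fun h => hv (Y.submodule.smul_mem _ h)
  obtain ⟨w, hw, c, hc⟩ := huvU
  obtain ⟨a, ha⟩ := exists_sub_smul_mem_head hU hY hv' hv'Y hw
  have haU : w - a • v' ∈ U := U.sub_mem hw (U.smul_mem a hv')
  -- The left side is a `K`-multiple of `v'`, the right side lies in the head; so both vanish.
  have e1 : (c * algebraMap F K a - k) • v' = u - c • (w - a • v') := by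
    rw [sub_smul, mul_smul, algebraMap_smul_vec, smul_sub, hc]; abel
  have e2 : c * algebraMap F K a = k := by
    by_contra hne
    refine hv'Y ((Y.submodule.smul_mem_iff (sub_ne_zero.2 hne)).1 ?_)
    rw [e1]
    exact Y.submodule.sub_mem hu (Y.submodule.smul_mem _ ha)
  have e3 : u = c • (w - a • v') := by
    rw [e2, sub_self, zero_smul] at e1
    exact sub_eq_zero.1 e1.symm
  have ha0 : a ≠ 0 := by rintro rfl; simp at e2; exact hk0 e2.symm
  refine ⟨Units.mk0 k hk0, Submodule.smul_mem_pointwise_smul v' (Units.mk0 k hk0) U hv', ?_⟩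
  rw [mem_units_smul_iff, ← U.smul_mem_iff ha0]
  convert haU using 1
  rw [e3, ← algebraMap_smul_vec, Units.smul_def, smul_smul, smul_smul]
  have : algebraMap F K a ≠ 0 := by simpa using ha0
  have hc0 : c ≠ 0 := by rintro rfl; simp at e2; exact hk0 e2.symm
  have : algebraMap F K a * (((Units.mk0 k hk0)⁻¹ : Kˣ) : K) * c = 1 := by
    simp [← e2]
    field_simp
  rw [this, one_smul]

end Club

/-! ### Recognising a quadratic subfield. -/

/-- A two-dimensional subspace containing `1`, `z ∉ F` and `z / ((1 - s) z + s)`, where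
`s ≠ 0, 1`, is a field. -/
theorem exists_intermediateField_of_finrank_two [FiniteDimensional F K] {W : Submodule F K}
    (hW : Module.finrank F W = 2) (h1 : (1 : K) ∈ W) {z : K} (hz : z ∈ W)
    (hzF : ∀ a : F, algebraMap F K a ≠ z) {s : F} (hs0 : s ≠ 0) (hs1 : s ≠ 1)
    (hs : z / ((1 - algebraMap F K s) * z + algebraMap F K s) ∈ W) :
    ∃ E : IntermediateField F K, Module.finrank F E = 2 ∧ ∀ x, x ∈ E ↔ x ∈ W := by
  have hspan : W = Submodule.span F {1, z} := by
    refine (Submodule.eq_of_le_of_finrank_le (Submodule.span_le.2 ?_) ?_).symm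
    · rintro x (rfl | rfl)
      exacts [h1, hz]
    · have hli : LinearIndependent F ![(1 : K), z] := by
        rw [LinearIndependent.pair_iff' one_ne_zero]
        intro a
        rw [← Algebra.algebraMap_eq_smul_one]
        exact hzF a
      have := finrank_span_eq_card hli
      rw [Matrix.range_cons_cons_empty] at this
      rw [hW, this]
      simp
  have hlin : ∀ a b : F, algebraMap F K a + algebraMap F K b * z = 0 → a = 0 ∧ b = 0 := by
    intro a b h
    have hb : b = 0 := by
      by_contra hb
      have hb' : algebraMap F K b ≠ 0 := by simpa using hb
      apply hzF (-a / b)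
      rw [map_div₀, map_neg]
      field_simp
      linear_combination -h
    subst hb
    simpa using h
  have hmem : ∀ x, x ∈ W ↔ ∃ a b : F, algebraMap F K a + algebraMap F K b * z = x := by
    intro x
    rw [hspan, Submodule.mem_span_pair]
    simp only [Algebra.smul_def, mul_one]
  have hden : (1 - algebraMap F K s) * z + algebraMap F K s ≠ 0 := by
    intro h
    refine hs0 (hlin s (1 - s) ?_).1
    rw [map_sub, map_one]
    linear_combination h
  obtain ⟨a, b, hab⟩ := (hmem _).1 hs
  rw [eq_div_iff hden] at hab
  -- Otherwise the quotient would be in `F`, giving a nontrivial linear relation between `1` and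
  -- `z`.
  have hb : b ≠ 0 := by
    rintro rfl
    have h := hlin (a * s) (a * (1 - s) - 1) (by
      simp only [map_mul, map_sub, map_one, map_zero] at hab ⊢
      linear_combination hab)
    have ha : a = 0 := (mul_eq_zero.1 h.1).resolve_right hs0
    simpa [ha] using h.2
  have hzz : z * z ∈ W := by
    rw [hmem]
    have h1s : 1 - s ≠ 0 := sub_ne_zero.2 (Ne.symm hs1)
    have hb' : algebraMap F K b ≠ 0 := by simpa using hb
    have h1s' : 1 - algebraMap F K s ≠ 0 := by
      rw [← map_one (algebraMap F K), ← map_sub]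
      exact (map_ne_zero _).2 h1s
    -- Solves `(a + b z)((1 - s) z + s) = z` for `z²`; the leading coefficient is `b (1 - s)`.
    refine ⟨-(a * s) / (b * (1 - s)), (1 - a * (1 - s) - b * s) / (b * (1 - s)), ?_⟩
    simp only [map_div₀, map_mul, map_sub, map_neg, map_one]
    field_simp
    linear_combination -hab
  obtain ⟨p, r, hpr⟩ := (hmem _).1 hzz
  let A : Subalgebra F K := W.toSubalgebra h1 (by
    intro x y hx hy
    obtain ⟨a, b, rfl⟩ := (hmem x).1 hx
    obtain ⟨c, d, rfl⟩ := (hmem y).1 hy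
    refine (hmem _).2 ⟨a * c + b * d * p, a * d + b * c + b * d * r, ?_⟩
    simp only [map_mul, map_add]
    linear_combination (algebraMap F K b * algebraMap F K d) * hpr)
  exact ⟨A.toIntermediateField' (Subalgebra.isField_of_algebraic A), hW, fun x => Iff.rfl⟩

/-! ### Quadratic sublines and lines covered by the club. -/

section Club

variable {U : Submodule F (Fin 2 → K)} {Y : ℙ K (Fin 2 → K)}

/-- A club whose defining subspace is spanned by a vector outside of the head and a multiple of
a quadratic extension field is a quadratic subline. -/
theorem isIsomorphicToQuadraticSubline_of_intermediateField [FiniteDimensional F K]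
    (hU : Module.finrank F U = 3) (hY : weight U Y = 2) {v d : Fin 2 → K} (hv : v ∈ U)
    (hvY : v ∉ Y.submodule) (hd0 : d ≠ 0) (hdY : d ∈ Y.submodule) {E : IntermediateField F K}
    (hE : Module.finrank F E = 2) (hEU : ∀ x, x ∈ E ↔ x • d ∈ U) :
    IsIsomorphicToQuadraticSubline F (linearSet U) := by
  let f : (Fin 2 → K) →ₗ[K] (Fin 2 → K) := Fintype.linearCombination K ![v, d]
  have hf : ∀ x, f x = x 0 • v + x 1 • d := by
    intro x
    simp [f, Fintype.linearCombination_apply, Fin.sum_univ_two]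
  have hfi : Function.Injective f := by
    rw [← LinearMap.ker_eq_bot, LinearMap.ker_eq_bot']
    intro x hx
    rw [hf] at hx
    have h0 : x 0 = 0 := by
      by_contra h0
      refine hvY ((Y.submodule.smul_mem_iff h0).1 ?_)
      rw [eq_neg_of_add_eq_zero_left hx]
      exact Y.submodule.neg_mem (Y.submodule.smul_mem _ hdY)
    have h1 : x 1 = 0 := by
      rw [h0, zero_smul, zero_add] at hx
      exact (smul_eq_zero.1 hx).resolve_right hd0
    ext i
    fin_cases i
    · exact h0
    · exact h1
  let g := LinearEquiv.ofInjectiveEndo f hfi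
  have hg : ∀ x, g x = x 0 • v + x 1 • d := fun x => by
    rw [← hf]; rfl
  refine ⟨E, hE, g, ?_⟩
  ext P
  constructor
  · rintro ⟨u, hu, hu0, rfl⟩
    obtain ⟨a, ha⟩ := exists_sub_smul_mem_head hU hY hv hvY hu
    rw [submodule_eq_span hd0 hdY, Submodule.mem_span_singleton] at ha
    obtain ⟨y, hy⟩ := ha
    have hgu : g ![algebraMap F K a, y] = u := by
      rw [hg]
      simp [hy]
    have hne : ![algebraMap F K a, y] ≠ 0 := by
      intro h
      rw [h, map_zero] at hgu
      exact hu0 hgu.symm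
    refine ⟨_, ⟨![algebraMap F K a, y], ?_, hne, rfl⟩, ?_⟩
    · intro i
      fin_cases i
      · exact E.algebraMap_mem a
      · refine (hEU y).2 ?_
        rw [hy]
        exact U.sub_mem hu (U.smul_mem a hv)
    · rw [Projectivization.map_mk]
      congr 1
  · rintro ⟨_, ⟨x, hx, hx0, rfl⟩, rfl⟩
    rw [Projectivization.map_mk]
    have hgx0 : g x ≠ 0 := by simpa using hx0
    change Projectivization.mk K (g x) hgx0 ∈ linearSet U
    by_cases h0 : x 0 = 0
    · have hdU : d ∈ U := by simpa using (hEU 1).1 E.one_mem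
      refine ⟨d, hdU, hd0, ?_⟩
      rw [Projectivization.mk_eq_mk_iff']
      have h1 : x 1 ≠ 0 := by
        intro h1
        apply hx0
        ext i
        fin_cases i
        · exact h0
        · exact h1
      refine ⟨(x 1)⁻¹, ?_⟩
      rw [hg, h0, zero_smul, zero_add, smul_smul, inv_mul_cancel₀ h1, one_smul]
    -- Coefficients of `v` in `U` are limited to `F`, so the first coordinate is scaled to `1`.
    · have hmem : v + ((x 0)⁻¹ * x 1) • d ∈ U :=
        U.add_mem hv ((hEU _).1 (E.mul_mem (E.inv_mem (hx 0)) (hx 1)))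
      have hEq : x 0 • (v + ((x 0)⁻¹ * x 1) • d) = g x := by
        rw [hg, smul_add, smul_smul, mul_inv_cancel_left₀ h0]
      refine ⟨_, hmem, ?_, ?_⟩
      · intro h
        rw [h, smul_zero] at hEq
        exact hgx0 hEq.symm
      · rw [Projectivization.mk_eq_mk_iff']
        refine ⟨(x 0)⁻¹, ?_⟩
        rw [← hEq, smul_smul, inv_mul_cancel₀ h0, one_smul]

/-- The coefficients of the points of a club along a line that joins `v` to `k • (v + d)`. -/
theorem div_one_add_smul_mem [FiniteDimensional F K] (hU : Module.finrank F U = 3)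
    (hY : weight U Y = 2) {v d : Fin 2 → K} (hv : v ∈ U) (hvY : v ∉ Y.submodule)
    (hdU : d ∈ U) (hdY : d ∈ Y.submodule) {k : K} {t : F}
    (ht : 1 + algebraMap F K t * k ≠ 0)
    (h : ∃ u ∈ U, ∃ c : K, c • u = v + t • k • (v + d)) :
    (1 / (1 + algebraMap F K t * k)) • d ∈ U := by
  obtain ⟨u, hu, c, hc⟩ := h
  obtain ⟨a, ha⟩ := exists_sub_smul_mem_head hU hY hv hvY hu
  have haU : u - a • v ∈ U := U.sub_mem hu (U.smul_mem a hv)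
  rw [← algebraMap_smul_vec t] at hc
  have e1 : (1 + algebraMap F K t * k - c * algebraMap F K a) • v =
      c • (u - a • v) - (algebraMap F K t * k) • d := by
    rw [smul_sub, hc, ← algebraMap_smul_vec a v]
    module
  have e2 : 1 + algebraMap F K t * k = c * algebraMap F K a := by
    by_contra hne
    refine hvY ((Y.submodule.smul_mem_iff (sub_ne_zero.2 hne)).1 ?_)
    rw [e1]
    exact Y.submodule.sub_mem (Y.submodule.smul_mem _ ha) (Y.submodule.smul_mem _ hdY)
  have e3 : (algebraMap F K t * k) • d = c • (u - a • v) := by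
    rw [e2, sub_self, zero_smul] at e1
    exact (sub_eq_zero.1 e1.symm).symm
  rw [e2] at ht
  have hc0 : c ≠ 0 := left_ne_zero_of_mul ht
  have ha0 : algebraMap F K a ≠ 0 := right_ne_zero_of_mul ht
  have e4 : d - (1 / (1 + algebraMap F K t * k)) • d = a⁻¹ • (u - a • v) := by
    have : (1 - 1 / (1 + algebraMap F K t * k)) =
        (algebraMap F K a)⁻¹ * c⁻¹ * (algebraMap F K t * k) := by
      rw [e2]
      field_simp
      linear_combination -e2
    calc _ = (1 - 1 / (1 + algebraMap F K t * k)) • d := by rw [sub_smul, one_smul]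
      _ = _ := by
        rw [this, mul_smul, e3, smul_smul, mul_assoc, inv_mul_cancel₀ hc0, mul_one,
          ← algebraMap_smul_vec a⁻¹, map_inv₀]
  have e5 : (1 / (1 + algebraMap F K t * k)) • d = d - a⁻¹ • (u - a • v) := by
    rw [← e4]; abel
  rw [e5]
  exact U.sub_mem hdU (U.smul_mem _ haU)

/-- If `v` and `k • (v + d)` span a line disjoint from the head and covered by the club, then the
club is a quadratic subline. -/
theorem isIsomorphicToQuadraticSubline_of_line [Finite F] [FiniteDimensional F K]
    (hq : 2 < Nat.card F) (hU : Module.finrank F U = 3)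
    (hY : weight U Y = 2) {v d : Fin 2 → K} (hv : v ∈ U) (hvY : v ∉ Y.submodule)
    (hd0 : d ≠ 0) (hdU : d ∈ U) (hdY : d ∈ Y.submodule) {k : K}
    (hk : ∀ a : F, algebraMap F K a ≠ k)
    (h : ∀ t : F, ∃ u ∈ U, ∃ c : K, c • u = v + t • k • (v + d)) :
    IsIsomorphicToQuadraticSubline F (linearSet U) := by
  have hden : ∀ t : F, 1 + algebraMap F K t * k ≠ 0 := by
    intro t ht
    have ht0 : algebraMap F K t ≠ 0 := by intro h0; simp [h0] at ht
    apply hk (-t⁻¹)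
    rw [map_neg, map_inv₀]
    field_simp
    linear_combination -ht
  -- Here `q > 2` supplies a third parameter besides `0` and `1`.
  obtain ⟨s, hs0, hs1⟩ : ∃ s : F, s ≠ 0 ∧ s ≠ 1 := by
    by_contra! hcon
    have hsub : (Set.univ : Set F) ⊆ {0, 1} := by
      intro s _
      by_cases hs : s = 0
      · exact Or.inl hs
      · exact Or.inr (hcon s hs)
    have := (Set.ncard_le_ncard hsub).trans (Set.ncard_insert_le _ _)
    rw [Set.ncard_univ, Set.ncard_singleton] at this
    omega
  let f : K →ₗ[F] (Fin 2 → K) := (LinearMap.toSpanSingleton K (Fin 2 → K) d).restrictScalars F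
  have hf : ∀ x, f x = x • d := fun x => rfl
  have hfi : Function.Injective f := fun x y hxy => smul_left_injective K hd0 hxy
  let W : Submodule F K := U.comap f
  have hWmap : W.map f = U ⊓ fieldReduction F Y := by
    rw [Submodule.map_comap_eq, inf_comm]
    congr 1
    ext x
    rw [mem_fieldReduction, submodule_eq_span hd0 hdY, Submodule.mem_span_singleton]
    rfl
  have hW : Module.finrank F W = 2 := by
    rw [(Submodule.equivMapOfInjective f hfi W).finrank_eq, hWmap]
    exact hY
  have hmemW : ∀ t : F, 1 / (1 + algebraMap F K t * k) ∈ W := fun t =>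
    div_one_add_smul_mem hU hY hv hvY hdU hdY (hden t) (h t)
  have h1k : 1 + k ≠ 0 := by simpa using hden 1
  -- With `z = 1 / (1 + k)`, the value `1 / (1 + s k)` equals `z / ((1 - s) z + s)`.
  obtain ⟨E, hE, hEW⟩ := exists_intermediateField_of_finrank_two hW (z := 1 / (1 + k))
    (by simpa using hmemW 0) (by simpa using hmemW 1)
    (by
      intro a ha
      have ha0 : algebraMap F K a ≠ 0 := by
        rw [ha]; exact one_div_ne_zero h1k
      apply hk (a⁻¹ - 1)
      rw [map_sub, map_inv₀, ha]
      simp) hs0 hs1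
    (by
      convert hmemW s using 1
      have h2 := hden s
      have h3 : (1 - algebraMap F K s) * (1 / (1 + k)) + algebraMap F K s =
          (1 + algebraMap F K s * k) / (1 + k) := by
        field_simp
        ring
      rw [h3]
      field_simp)
  exact isIsomorphicToQuadraticSubline_of_intermediateField hU hY hv hvY hd0 hdY hE hEW

/-- The lines covered by a club that is not a quadratic subline. -/
theorem line_le_of_points_subset_reducedPoints [Finite F] [FiniteDimensional F K]
    (hq : 2 < Nat.card F) (hU : Module.finrank F U = 3) (hY : weight U Y = 2)
    (hL : ¬ IsIsomorphicToQuadraticSubline F (linearSet U)) {l : Submodule F (Fin 2 → K)}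
    (hl : Module.finrank F l = 2) (hlL : points l ⊆ reducedPoints F (linearSet U)) :
    l ≤ fieldReduction F Y ∨
      (∃ P ∈ linearSet U, P ≠ Y ∧ l ≤ fieldReduction F P) ∨ ∃ k : Kˣ, l ≤ k • U := by
  rw [points_subset_reducedPoints_linearSet_iff] at hlL
  have hlL' : ∀ v ∈ l, ∃ u ∈ U, ∃ k : K, k • u = v := by
    intro v hv
    by_cases hv0 : v = 0
    · exact ⟨0, U.zero_mem, 0, by simp [hv0]⟩
    · exact hlL v hv hv0
  by_cases hlY : l ≤ fieldReduction F Y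
  · exact Or.inl hlY
  right
  obtain ⟨v, hvl, hvY'⟩ := SetLike.not_le_iff_exists.1 hlY
  have hvY : v ∉ Y.submodule := hvY'
  have hv0 : v ≠ 0 := by rintro rfl; exact hvY Y.submodule.zero_mem
  have hspan : ∀ u ∈ l, (∀ a : F, a • v ≠ u) → l = Submodule.span F {v, u} := by
    intro u hu hne
    refine (Submodule.eq_of_le_of_finrank_le (Submodule.span_le.2 ?_) ?_).symm
    · rintro x (rfl | rfl)
      exacts [hvl, hu]
    · have hli : LinearIndependent F ![v, u] := (LinearIndependent.pair_iff' hv0).2 hne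
      have := finrank_span_eq_card hli
      rw [Matrix.range_cons_cons_empty] at this
      rw [hl, this]
      simp
  by_cases hdis : ∃ u ∈ l, u ∈ Y.submodule ∧ u ≠ 0
  · right
    obtain ⟨u, hul, huY, hu0⟩ := hdis
    obtain ⟨k, hk1, hk2⟩ := le_units_smul_of_mem_head hU hY huY hvY (hlL' v hvl)
      (hlL' _ (l.add_mem hvl hul))
    refine ⟨k, ?_⟩
    rw [hspan u hul, Submodule.span_le]
    · rintro x (rfl | rfl)
      exacts [hk1, hk2]
    · rintro a rfl
      have ha : a ≠ 0 := by rintro rfl; simp at hu0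
      rw [← algebraMap_smul_vec] at huY
      exact hvY ((Y.submodule.smul_mem_iff (by simpa using ha)).1 huY)
  · left
    push Not at hdis
    obtain ⟨v', hv', c, hc⟩ := hlL' v hvl
    have hc0 : c ≠ 0 := by rintro rfl; simp at hc; exact hv0 hc.symm
    have hv'Y : v' ∉ Y.submodule := fun h => hvY (hc ▸ Y.submodule.smul_mem _ h)
    have hv'0 : v' ≠ 0 := by rintro rfl; exact hv'Y Y.submodule.zero_mem
    refine ⟨Projectivization.mk K v' hv'0, ⟨v', hv', hv'0, rfl⟩, ?_, ?_⟩
    · rintro rfl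
      exact hv'Y (by simp)
    intro x hx
    rw [mem_fieldReduction, Projectivization.submodule_mk, Submodule.mem_span_singleton]
    by_contra hxv
    have hxY : x ∉ Y.submodule := fun h => hxv ⟨0, by simp [hdis x hx h]⟩
    obtain ⟨x', hx', k, hk⟩ := hlL' x hx
    obtain ⟨a, ha⟩ := exists_sub_smul_mem_head hU hY hv' hv'Y hx'
    have hx'Y : x' ∉ Y.submodule := fun h => hxY (hk ▸ Y.submodule.smul_mem _ h)
    have ha0 : a ≠ 0 := by rintro rfl; simp at ha; exact hx'Y ha
    have ha0' : algebraMap F K a ≠ 0 := by simpa using ha0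
    -- Normalises `x'` to a multiple of `v' + d` with `d` in the head.
    set d := a⁻¹ • (x' - a • v') with hd
    have hx'd : x' = a • (v' + d) := by
      rw [hd, smul_add, smul_smul, mul_inv_cancel₀ ha0, one_smul]; abel
    have hdU : d ∈ U := U.smul_mem _ (U.sub_mem hx' (U.smul_mem a hv'))
    have hdY : d ∈ Y.submodule := by
      rw [hd, ← algebraMap_smul_vec]; exact Y.submodule.smul_mem _ ha
    have hxd : x = (k * algebraMap F K a) • (v' + d) := by
      rw [mul_smul, algebraMap_smul_vec, ← hx'd, hk]
    have hd0 : d ≠ 0 := by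
      intro h
      rw [h, add_zero] at hxd
      exact hxv ⟨_, hxd.symm⟩
    have hk0 : k ≠ 0 := by rintro rfl; simp at hk; exact hxY (hk ▸ Y.submodule.zero_mem)
    refine hL (isIsomorphicToQuadraticSubline_of_line hq hU hY hv' hv'Y hd0 hdU hdY
      (k := c⁻¹ * (k * algebraMap F K a)) ?_ ?_)
    -- A ratio `b ∈ F` would make `x - b • v` a nonzero vector of `l` in the head.
    · intro b hb
      have e : k * algebraMap F K a = algebraMap F K b * c := by
        rw [hb]; field_simp
      have hb0 : algebraMap F K b * c ≠ 0 := e ▸ mul_ne_zero hk0 ha0'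
      rw [e] at hxd
      have h1 : x - b • v = (algebraMap F K b * c) • d := by
        rw [hxd, ← hc, ← algebraMap_smul_vec]; module
      have h2 := hdis (x - b • v) (l.sub_mem hx (l.smul_mem b hvl))
        (h1 ▸ Y.submodule.smul_mem _ hdY)
      rw [h1] at h2
      exact (smul_ne_zero hb0 hd0) h2
    · intro t
      obtain ⟨u, hu, e, he⟩ := hlL' (v + t • x) (l.add_mem hvl (l.smul_mem t hx))
      refine ⟨u, hu, c⁻¹ * e, ?_⟩
      rw [mul_smul, he, smul_add, ← hc, smul_smul, inv_mul_cancel₀ hc0, one_smul, hxd,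
        ← algebraMap_smul_vec, ← algebraMap_smul_vec]
      module

end Club

end LinearSetClub

theorem proposition5p2 {F K : Type*} [Field F] [Finite F] [Field K] [Algebra F K]
    (q n : ℕ) (hq : Nat.card F = q) (hn : Module.finrank F K = n) (hn2 : 2 < n)
    (L : Set (ℙ K (Fin 2 → K))) (Y : ℙ K (Fin 2 → K))
    (hL : LinearSetClub.IsClubWithHead F L Y) :
    ∃ F₁ F₂ : Set (Submodule F (Fin 2 → K)),
      -- all members of both families are contained in the point set of the club
      (∀ S ∈ F₁ ∪ F₂, LinearSetClub.points S ⊆ LinearSetClub.reducedPoints F L) ∧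
      -- (i)
      ((∀ S ∈ F₁, Module.finrank F S = n) ∧
        (∀ S ∈ F₁, ∀ T ∈ F₁, S ≠ T →
          Disjoint (LinearSetClub.points S) (LinearSetClub.points T)) ∧
        (∀ S ∈ F₁, Disjoint (LinearSetClub.points S)
          (LinearSetClub.points (LinearSetClub.fieldReduction F Y)))) ∧
      -- (ii)
      (∀ S ∈ F₂, Module.finrank F S = 3 ∧
        Module.finrank F ↥(S ⊓ LinearSetClub.fieldReduction F Y) = 2) ∧
      -- (iii)
      (∀ x ∈ LinearSetClub.points (LinearSetClub.fieldReduction F Y),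
        {S | S ∈ F₂ ∧ x ∈ LinearSetClub.points S}.ncard = q + 1) ∧
      -- (iv)
      (2 < q → ¬ LinearSetClub.IsIsomorphicToQuadraticSubline F L →
        ∀ l : Submodule F (Fin 2 → K), Module.finrank F l = 2 →
          LinearSetClub.points l ⊆ LinearSetClub.reducedPoints F L →
          l ≤ LinearSetClub.fieldReduction F Y ∨ ∃ S ∈ F₁ ∪ F₂, l ≤ S) := by
  obtain ⟨U, hU, rfl, hY⟩ := hL
  subst hq
  have : FiniteDimensional F K := Module.finite_of_finrank_pos (by omega)
  refine ⟨{S | ∃ P ∈ LinearSetClub.linearSet U, P ≠ Y ∧ LinearSetClub.fieldReduction F P = S},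
    Set.range (fun k : Kˣ => k • U), ?_, ⟨?_, ?_, ?_⟩, ?_, ?_, ?_⟩
  · rintro S (⟨P, hP, -, rfl⟩ | ⟨k, rfl⟩)
    · exact Set.subset_biUnion_of_mem (u := fun P =>
        LinearSetClub.points (LinearSetClub.fieldReduction F P)) hP
    · rw [LinearSetClub.points_subset_reducedPoints_linearSet_iff]
      intro v hv _
      obtain ⟨u, hu, rfl⟩ := (Submodule.mem_smul_pointwise_iff_exists _ _ _).1 hv
      exact ⟨u, hu, k, rfl⟩
  · rintro S ⟨P, -, -, rfl⟩
    rw [LinearSetClub.finrank_fieldReduction, hn]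
  · rintro S ⟨P, -, -, rfl⟩ T ⟨Q, -, -, rfl⟩ hne
    exact LinearSetClub.disjoint_points_of_disjoint
      (LinearSetClub.disjoint_fieldReduction fun h => hne (h ▸ rfl))
  · rintro S ⟨P, -, hPY, rfl⟩
    exact LinearSetClub.disjoint_points_of_disjoint (LinearSetClub.disjoint_fieldReduction hPY)
  · rintro S ⟨k, rfl⟩
    refine ⟨(LinearSetClub.finrank_units_smul U k).trans hU, ?_⟩
    refine (congrArg (fun T : Submodule F (Fin 2 → K) => Module.finrank F T)
      (LinearSetClub.units_smul_inf_fieldReduction U k Y)).trans ?_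
    exact (LinearSetClub.finrank_units_smul _ k).trans hY
  · intro x
    induction x using Projectivization.ind with
    | h v hv0 =>
      intro hv
      simp only [LinearSetClub.mk_mem_points] at hv ⊢
      exact LinearSetClub.ncard_units_smul_through_point hU hY hv0 hv
  · intro hq hiso l hl hlL
    rcases LinearSetClub.line_le_of_points_subset_reducedPoints hq hU hY hiso hl hlL with
      h | ⟨P, hP, hPY, h⟩ | ⟨k, h⟩
    · exact Or.inl h
    · exact Or.inr ⟨_, Or.inl ⟨P, hP, hPY, rfl⟩, h⟩
    · exact Or.inr ⟨_, Or.inr ⟨k, rfl⟩, h⟩
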